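/- Let $p\equiv 3\pmod 4$ be a prime. For a prime $q$ with $$q\equiv 3\pmod 8,\qquad \left(\frac{p}{q}\right)=-1 \tag{1}$$ and an integer $r$ with $r^2+p\equiv 0\pmod q$, let $B=\mathbb{Q}+\mathbb{Q}\alpha+\mathbb{Q}\beta+\mathbb{Q}\alpha\beta$ be the quaternion algebra over $\mathbb{Q}$ with $\alpha^2=-p$, $\beta^2=-q$, $\alpha\beta=-\beta\alpha$, and let $\mathcal{O}(q,r)$ be the subring $$\mathcal{O}(q,r)=\mathbb{Z}+\mathbb{Z}\,\frac{1+\beta}{2}+\mathbb{Z}\,\frac{\alpha(1+\beta)}{2}+\mathbb{Z}\,\frac{(r+\alpha)\beta}{q}$$ of $B$. Let $q_1\neq q_2$ be primes satisfying (1), and let $r_1,r_2$ be integers with $r_i^2+p\equiv 0\pmod{q_i}$ for $i=1,2$. Then $\mathcal{O}(q_1,r_1)$ and $\mathcal{O}(q_2,r_2)$ are isomorphic as rings if and only if there is a primitive reduced positive definite binary quadratic form $aX^2+bXY+cY^2$ with $a,b,c\in\mathbb{Z}$ and discriminant $b^2-4ac=-16p$ which represents both $q_1$ and $q_2$. Here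 the form is primitive if $\gcd(a,b,c)=1$, it is reduced if $-a<b\le a$, $a\le c$, and $b\ge 0$ whenever $a=c$, and it represents $n$ if $n=ax^2+bxy+cy^2$ for some $x,y\in\mathbb{Z}$. -/

import Mathlib

open scoped Quaternion

/-- The binary quadratic form `a X ^ 2 + b X Y + c Y ^ 2` with integer coefficients. -/
@[ext]
structure BinForm where
  a : ℤ
  b : ℤ
  c : ℤ

namespace BinForm

/-- The value `f(x, y)`. -/
def eval (f : BinForm) (x y : ℤ) : ℤ := f.a * x ^ 2 + f.b * x * y + f.c * y ^ 2

/-- The discriminant `b ^ 2 - 4 a c`. -/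
def discr (f : BinForm) : ℤ := f.b ^ 2 - 4 * f.a * f.c

/-- Positive definiteness: negative discriminant and positive leading coefficient. -/
def IsPosDef (f : BinForm) : Prop := f.discr < 0 ∧ 0 < f.a

/-- A form is primitive if `gcd(a, b, c) = 1`. -/
def IsPrimitive (f : BinForm) : Prop := Int.gcd f.a (Int.gcd f.b f.c) = 1

/-- The reducedness conditions `-a < b ≤ a`, `a ≤ c`, and `b ≥ 0` if `a = c`. -/
def IsReduced (f : BinForm) : Prop :=
  (-f.a < f.b ∧ f.b ≤ f.a) ∧ f.a ≤ f.c ∧ (f.a = f.c → 0 ≤ f.b)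

/-- The integer `n` is represented by `f`. -/
def Represents (f : BinForm) (n : ℤ) : Prop := ∃ x y : ℤ, f.eval x y = n

end BinForm

/-- The quaternion algebra `ℚ + ℚ α + ℚ β + ℚ α β` with `α ^ 2 = -p`, `β ^ 2 = -q` and
`α β = - β α`. -/
abbrev QuatAlg (p q : ℕ) : Type := ℍ[ℚ, -(p : ℚ), -(q : ℚ)]

namespace QuatAlg

/-- The generator `α`, with `α ^ 2 = -p`. -/
def α (p q : ℕ) : QuatAlg p q := ⟨0, 1, 0, 0⟩

/-- The generator `β`, with `β ^ 2 = -q`. -/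
def β (p q : ℕ) : QuatAlg p q := ⟨0, 0, 1, 0⟩

theorem α_mul_α (p q : ℕ) : α p q * α p q = -(p : QuatAlg p q) := by
  ext <;> simp [α]

theorem β_mul_β (p q : ℕ) : β p q * β p q = -(q : QuatAlg p q) := by
  ext <;> simp [β]

theorem α_mul_β (p q : ℕ) : α p q * β p q = -(β p q * α p q) := by
  ext <;> simp [α, β]

/-- The lattice `ℤ + ℤ (1 + β) / 2 + ℤ α (1 + β) / 2 + ℤ (r + α) β / q`. -/
def lattice (p q : ℕ) (r : ℤ) : Submodule ℤ (QuatAlg p q) :=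
  Submodule.span ℤ
    {1, (1 / 2 : ℚ) • (1 + β p q), (1 / 2 : ℚ) • (α p q * (1 + β p q)),
      (1 / (q : ℚ)) • (((r : QuatAlg p q) + α p q) * β p q)}

theorem mem_lattice_iff {p q : ℕ} {r : ℤ} {x : QuatAlg p q} :
    x ∈ lattice p q r ↔ ∃ a b c d : ℤ,
      x = ⟨a + b / 2, c / 2, b / 2 + d * r / q, c / 2 + d / q⟩ := by
  unfold lattice
  simp only [Submodule.mem_span_insert, Submodule.mem_span_singleton]
  constructor
  · rintro ⟨a, _, ⟨b, _, ⟨c, _, ⟨d, rfl⟩, rfl⟩, rfl⟩, rfl⟩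
    refine ⟨a, b, c, d, ?_⟩
    ext <;> simp [α, β] <;> ring
  · rintro ⟨a, b, c, d, rfl⟩
    refine ⟨a, _, ⟨b, _, ⟨c, _, ⟨d, rfl⟩, rfl⟩, rfl⟩, ?_⟩
    ext <;> simp [α, β] <;> ring

theorem one_mem_lattice (p q : ℕ) (r : ℤ) : (1 : QuatAlg p q) ∈ lattice p q r :=
  Submodule.subset_span (by simp)

theorem mul_mem_lattice {p q : ℕ} {r : ℤ} (hq : q % 8 = 3) (hr : (q : ℤ) ∣ r ^ 2 + p)
    {x y : QuatAlg p q} (hx : x ∈ lattice p q r) (hy : y ∈ lattice p q r) :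
    x * y ∈ lattice p q r := by
  obtain ⟨a, b, c, d, rfl⟩ := mem_lattice_iff.1 hx
  obtain ⟨a', b', c', d', rfl⟩ := mem_lattice_iff.1 hy
  obtain ⟨m, hm⟩ := hr
  obtain ⟨k, hk⟩ : ∃ k : ℤ, (q : ℤ) = 4 * k - 1 := ⟨(q + 1) / 4, by omega⟩
  have hq0 : (q : ℚ) ≠ 0 := by
    have : q ≠ 0 := by omega
    exact_mod_cast this
  have hpQ : (p : ℚ) = q * m - r ^ 2 := by
    have : (p : ℤ) = q * m - r ^ 2 := by linarith
    exact_mod_cast this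
  have hkQ : (k : ℚ) = (q + 1) / 4 := by
    have : (q : ℚ) = 4 * k - 1 := by exact_mod_cast hk
    linarith
  refine mem_lattice_iff.2
    ⟨a * a' - k * b * b' - p * k * c * c' - m * d * d' - r * b * d' + r * k * (c * b' - b * c')
        + (m * (1 - 2 * k) + r ^ 2) * c * d' - 2 * k * m * d * c',
      a * b' + b * b' + b * a' - 2 * r * k * (c * b' - b * c') + r * (b * d' - d * b')
        + (m + r ^ 2) * (d * c' - c * d'),
      a * c' + c * a' + 2 * k * b * c' + (1 - 2 * k) * c * b' + b * d' - d * b'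
        + r * (d * c' - c * d'),
      a * d' + d * a' + q * k * (c * b' - b * c') + (1 - 2 * k) * b * d' + 2 * k * d * b'
        + 2 * k * r * (c * d' - d * c'), ?_⟩
  ext <;> simp <;> rw [hkQ] <;> (try rw [hpQ]) <;> field_simp <;> ring

/-- The order `𝒪(q, r) = ℤ + ℤ (1 + β) / 2 + ℤ α (1 + β) / 2 + ℤ (r + α) β / q`, as a subring of
the quaternion algebra, for `q ≡ 3 (mod 8)` and `r ^ 2 + p ≡ 0 (mod q)`. -/
def order (p q : ℕ) (r : ℤ) (hq : q % 8 = 3) (hr : (q : ℤ) ∣ r ^ 2 + p) :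
    Subring (QuatAlg p q) where
  carrier := lattice p q r
  mul_mem' := mul_mem_lattice hq hr
  one_mem' := one_mem_lattice p q r
  add_mem' := (lattice p q r).add_mem
  zero_mem' := (lattice p q r).zero_mem
  neg_mem' := (lattice p q r).neg_mem

end QuatAlg

/-!
Put `r₁ ^ 2 + p = q₁ m`. Both sides of the equivalence say that `q₂` is a value of the form
`F = q₁ X ^ 2 + 4 r₁ X Y + 4 m Y ^ 2` of discriminant `-16 p`.

For binary forms: a form of discriminant `-16 p` representing the prime `q₁` can be moved to have
leading coefficient `q₁`; its middle coefficient is then determined modulo `2 q₁` up to sign, so the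
form is `F` up to a substitution of determinant `±1` (`BinForm.Represents.exists_norm_eq`).
Conversely `F` is equivalent to a reduced form (`BinForm.IsPosDef.exists_isReduced`), and a form
representing two different primes is primitive.

For orders: the elements of `𝒪(q₁, r₁)` orthogonal to `1` and `α` are the
`x β + y (r₁ + α) β / q₁`, with norm `q₁ x ^ 2 + 2 r₁ x y + m y ^ 2`. Such an element `b` satisfies
`(1 + b) / 2 ∈ 𝒪(q₁, r₁)` exactly if `x` is odd and `y` is even, so `F` gives the norms of the
possible images of `β` under a map sending `α` to `±α`. If `F` takes the value `q₂`, this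
yields an isomorphism (`QuatAlg.nonempty_ringEquiv_of_norm_eq`). Conversely, an isomorphism
`𝒪(q₂, r₂) → 𝒪(q₁, r₁)` sends `α` to some `a` with `a ^ 2 = -p`. As `α` generates the prime above
`p`, `a = α u` for a unit `u` (`QuatAlg.exists_eq_α_mul`). If `u` does not have order `4`, then `a`
is conjugate to `±α` by a unit, and `F` takes the value `q₂`. If `u` has order `4`, a congruence
modulo `4` shows `(1 + a) / 2 ∈ 𝒪(q₁, r₁)`, whereas `(1 + α) / 2 ∉ 𝒪(q₂, r₂)`
(`QuatAlg.exists_norm_eq_of_mem`).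
-/

/-! ### Reduction of binary quadratic forms -/

namespace BinForm

/-- A form representing a prime `q` can be carried by a unimodular substitution to one with
leading coefficient `q`. -/
theorem Represents.exists_leading_coeff {f : BinForm} {q : ℕ} (hq : q.Prime)
    (h : f.Represents q) : ∃ b c : ℤ, (⟨q, b, c⟩ : BinForm).discr = f.discr ∧
      ∀ n, f.Represents n → (⟨q, b, c⟩ : BinForm).Represents n := by
  obtain ⟨x, y, hxy⟩ := h
  simp only [eval] at hxy
  have hc : IsCoprime x y := by
    rw [Int.isCoprime_iff_gcd_eq_one, ← Int.natAbs_natCast (Int.gcd x y),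
      ← Int.isUnit_iff_natAbs_eq]
    refine (Nat.prime_iff_prime_int.1 hq).squarefree _ ?_
    obtain ⟨s, hs⟩ := Int.gcd_dvd_left x y
    obtain ⟨t, ht⟩ := Int.gcd_dvd_right x y
    generalize (Int.gcd x y : ℤ) = g at *
    exact ⟨f.a * s ^ 2 + f.b * s * t + f.c * t ^ 2, by rw [← hxy, hs, ht]; ring⟩
  obtain ⟨w, z, hwz⟩ := hc
  refine ⟨-2 * f.a * x * z + f.b * (x * w - y * z) + 2 * f.c * y * w, f.eval (-z) w, ?_, ?_⟩
  · simp only [discr, eval, ← hxy]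
    linear_combination (f.b ^ 2 - 4 * f.a * f.c) * (w * x + z * y + 1) * hwz
  · rintro n ⟨s, t, rfl⟩
    refine ⟨w * s + z * t, x * t - y * s, ?_⟩
    have hs : s = x * (w * s + z * t) - z * (x * t - y * s) := by linear_combination -s * hwz
    have ht : t = y * (w * s + z * t) + w * (x * t - y * s) := by linear_combination -t * hwz
    simp only [eval, ← hxy]
    conv_rhs => rw [hs, ht]
    ring

/-- Every positive definite form is equivalent to a reduced one, by descent on the leading
coefficient. -/
theorem IsPosDef.exists_isReduced {f : BinForm} (hf : f.IsPosDef) :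
    ∃ g : BinForm, g.IsPosDef ∧ g.IsReduced ∧ g.discr = f.discr ∧
      ∀ n, f.Represents n → g.Represents n := by
  induction hN : f.a.toNat using Nat.strong_induction_on generalizing f with
  | _ N ih =>
  subst hN
  obtain ⟨hD, ha⟩ := hf
  -- Translate so that `-a < b ≤ a`.
  obtain ⟨k, hk1, hk2⟩ : ∃ k : ℤ, -f.a < f.b + 2 * f.a * k ∧ f.b + 2 * f.a * k ≤ f.a := by
    refine ⟨-((f.b + f.a - 1) / (2 * f.a)), ?_, ?_⟩ <;>
    · have h1 := Int.emod_add_mul_ediv (f.b + f.a - 1) (2 * f.a)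
      have h2 := Int.emod_nonneg (f.b + f.a - 1) (b := 2 * f.a) (by omega)
      have h3 := Int.emod_lt_of_pos (f.b + f.a - 1) (b := 2 * f.a) (by omega)
      linarith
  let g : BinForm := ⟨f.a, f.b + 2 * f.a * k, f.a * k ^ 2 + f.b * k + f.c⟩
  have hgD : g.discr = f.discr := by simp only [g, discr]; ring
  have hgR : ∀ n, f.Represents n → g.Represents n := by
    rintro _ ⟨x, y, rfl⟩
    exact ⟨x - k * y, y, by simp only [g, eval]; ring⟩
  let g' : BinForm := ⟨g.c, -g.b, g.a⟩
  have hgD' : g'.discr = f.discr := by rw [← hgD]; simp only [g', discr]; ring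
  have hgR' : ∀ n, f.Represents n → g'.Represents n := by
    intro n hn
    obtain ⟨x, y, rfl⟩ := hgR n hn
    exact ⟨-y, x, by simp only [g', eval]; ring⟩
  have hc : 0 < g.c := by
    have h1 : g.b ^ 2 - 4 * g.a * g.c < 0 := hgD.trans_lt hD
    have h2 : (0 : ℤ) < g.a := ha
    by_contra h
    nlinarith [sq_nonneg g.b, mul_nonneg h2.le (sub_nonneg.2 (not_lt.1 h))]
  rcases lt_trichotomy g.a g.c with h | h | h
  · exact ⟨g, ⟨hgD ▸ hD, ha⟩, ⟨⟨hk1, hk2⟩, h.le, fun h' => absurd h' h.ne⟩, hgD, hgR⟩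
  · by_cases hb : 0 ≤ g.b
    · exact ⟨g, ⟨hgD ▸ hD, ha⟩, ⟨⟨hk1, hk2⟩, h.le, fun _ => hb⟩, hgD, hgR⟩
    · have hk1' : -g.a < g.b := hk1
      exact ⟨g', ⟨hgD' ▸ hD, hc⟩, ⟨⟨by change -g.c < -g.b; omega, by change -g.b ≤ g.c; omega⟩,
        h.symm.le, fun _ => by change 0 ≤ -g.b; omega⟩, hgD', hgR'⟩
  · have h' : g.c < f.a := h
    obtain ⟨e, he1, he2, he3, he4⟩ :=
      ih g'.a.toNat (by change g.c.toNat < _; omega) (f := g') ⟨hgD' ▸ hD, hc⟩ rfl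
    exact ⟨e, he1, he2, he3.trans hgD', fun n hn => he4 n (hgR' n hn)⟩

/-- A form representing two different primes is primitive. -/
theorem isPrimitive_of_represents {f : BinForm} {q₁ q₂ : ℕ} (hq₁ : q₁.Prime) (hq₂ : q₂.Prime)
    (hne : q₁ ≠ q₂) (h₁ : f.Represents q₁) (h₂ : f.Represents q₂) : f.IsPrimitive := by
  have key : ∀ n : ℕ, f.Represents n → Int.gcd f.a (Int.gcd f.b f.c) ∣ n := by
    rintro n ⟨x, y, hxy⟩
    have ha : (Int.gcd f.a (Int.gcd f.b f.c) : ℤ) ∣ f.a := Int.gcd_dvd_left ..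
    have hbc : (Int.gcd f.a (Int.gcd f.b f.c) : ℤ) ∣ Int.gcd f.b f.c := Int.gcd_dvd_right ..
    have hb := hbc.trans (Int.gcd_dvd_left ..)
    have hc := hbc.trans (Int.gcd_dvd_right ..)
    rw [← Int.natCast_dvd_natCast, ← hxy]
    exact dvd_add (dvd_add (ha.mul_right _) ((hb.mul_right _).mul_right _)) (hc.mul_right _)
  exact Nat.eq_one_of_dvd_coprimes ((Nat.coprime_primes hq₁ hq₂).2 hne) (key _ h₁) (key _ h₂)

/-- A form of discriminant `-16 p` representing a prime `q` with `q ∣ r ^ 2 + p` is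
equivalent to `q X ^ 2 + 4 r X Y + 4 m Y ^ 2` under a substitution of determinant `±1`. -/
theorem Represents.exists_norm_eq {f : BinForm} {p q : ℕ} (hq : q.Prime)
    (hf : f.discr = -16 * p) (h : f.Represents q) {r m n : ℤ} (hm : r ^ 2 + p = q * m)
    (hn : f.Represents n) : ∃ x y : ℤ, q * x ^ 2 + 4 * r * x * y + 4 * m * y ^ 2 = n := by
  obtain ⟨b, c, hD, hrep⟩ := h.exists_leading_coeff hq
  obtain ⟨x, y, rfl⟩ := hrep n hn
  rw [hf] at hD
  simp only [discr] at hD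
  simp only [eval]
  have hpr : Prime (q : ℤ) := Nat.prime_iff_prime_int.1 hq
  obtain ⟨b, rfl⟩ : ∃ b', b = 2 * b' := by
    have : Even (b ^ 2) := ⟨2 * (q * c) - 8 * p, by linear_combination hD⟩
    obtain ⟨b', hb'⟩ := (Int.even_pow.1 this).1
    exact ⟨b', by rw [hb']; ring⟩
  have hD' : b ^ 2 + 4 * p = q * c := by linarith
  -- One of the two roots `±2 r` of `-4 p` modulo `q` is congruent to `b`.
  obtain ⟨ε, l, hε, hl⟩ : ∃ ε l : ℤ, ε * ε = 1 ∧ b = 2 * ε * r + q * l := by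
    have hd : (q : ℤ) ∣ (b - 2 * r) * (b + 2 * r) :=
      ⟨c - 4 * m, by linear_combination hD' - 4 * hm⟩
    rcases hpr.dvd_or_dvd hd with ⟨l, hl⟩ | ⟨l, hl⟩
    · exact ⟨1, l, rfl, by linear_combination hl⟩
    · exact ⟨-1, l, rfl, by linear_combination hl⟩
  have hq0 : (q : ℤ) ≠ 0 := by exact_mod_cast hq.ne_zero
  have hc : c = 4 * m + 4 * ε * r * l + q * l ^ 2 := by
    refine mul_left_cancel₀ hq0 ?_
    rw [← hD', hl]
    linear_combination 4 * r ^ 2 * hε + 4 * hm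
  refine ⟨x + l * y, ε * y, ?_⟩
  rw [hl, hc]
  linear_combination 4 * m * y ^ 2 * hε

end BinForm

namespace QuatAlg

/-! ### The order and its sublattice orthogonal to `1` and `α` -/

/-- The element `x β + y (r + α) β / q` of the order. For `r ^ 2 + p = q m` its norm is
`q x ^ 2 + 2 r x y + m y ^ 2`, a form of discriminant `-4 p`. -/
def perp (p q : ℕ) (r x y : ℤ) : QuatAlg p q := ⟨0, 0, x + y * r / q, y / q⟩

theorem perp_mem_lattice (p q : ℕ) (r x y : ℤ) : perp p q r x y ∈ lattice p q r := by
  refine mem_lattice_iff.2 ⟨-x, 2 * x, 0, y, ?_⟩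
  ext <;> simp [perp]

theorem α_mem_lattice {p q : ℕ} (hq : q ≠ 0) (r : ℤ) : α p q ∈ lattice p q r := by
  have : (q : ℚ) ≠ 0 := by exact_mod_cast hq
  refine mem_lattice_iff.2 ⟨-r, 2 * r, 2, -q, ?_⟩
  ext <;> simp [α] <;> field_simp <;> ring

theorem half_one_add_β_mem_lattice (p q : ℕ) (r : ℤ) :
    (1 / 2 : ℚ) • (1 + β p q) ∈ lattice p q r :=
  Submodule.subset_span (by simp)

theorem intCast_mem_lattice (p q : ℕ) (r n : ℤ) : (n : QuatAlg p q) ∈ lattice p q r := by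
  refine mem_lattice_iff.2 ⟨n, 0, 0, 0, ?_⟩
  ext <;> simp

/-- As a ring, the order is generated by `α`, `(1 + β) / 2` and `(r + α) β / q`. -/
theorem order_le {p q : ℕ} {r : ℤ} {hq : q % 8 = 3} {hr : (q : ℤ) ∣ r ^ 2 + p}
    {S : Subring (QuatAlg p q)} (hα : α p q ∈ S) (hβ : (1 / 2 : ℚ) • (1 + β p q) ∈ S)
    (hγ : perp p q r 0 1 ∈ S) : order p q r hq hr ≤ S := by
  intro x hx
  have key : lattice p q r ≤ S.toAddSubgroup.toIntSubmodule := by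
    refine Submodule.span_le.2 ?_
    rintro y (rfl | rfl | rfl | rfl)
    · exact S.one_mem
    · exact hβ
    · rw [← mul_smul_comm]
      exact S.mul_mem hα hβ
    · have h : perp p q r 0 1 = (1 / (q : ℚ)) • (((r : QuatAlg p q) + α p q) * β p q) := by
        ext <;> simp [α, β, perp, div_eq_inv_mul]
      exact h ▸ hγ
  exact key hx

/-! ### Isomorphisms from representations -/

/-- The homomorphism with `α ↦ ε α` and `β ↦ u β + v α β`, for `ε = ±1` and `u β + v α β` of
norm `q'`. -/
noncomputable def hom (p q q' : ℕ) (ε u v : ℚ) (hε : ε * ε = 1)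
    (h : q * (u ^ 2 + p * v ^ 2) = q') : QuatAlg p q' →ₐ[ℚ] QuatAlg p q :=
  QuaternionAlgebra.Basis.liftHom
    { i := ⟨0, ε, 0, 0⟩
      j := ⟨0, 0, u, v⟩
      k := ⟨0, 0, -(ε * p * v), ε * u⟩
      i_mul_i := by
        ext <;> simp
        linear_combination (p : ℚ) * hε
      j_mul_j := by
        ext <;> simp
        · linear_combination -h
        · ring
      i_mul_j := by
        ext <;> simp
        exact Or.inl (mul_comm _ _)
      j_mul_i := by
        ext <;> simp <;> ring }

theorem hom_apply (p q q' : ℕ) (ε u v : ℚ) (hε : ε * ε = 1)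
    (h : q * (u ^ 2 + p * v ^ 2) = q') (x : QuatAlg p q') :
    hom p q q' ε u v hε h x =
      ⟨x.re, ε * x.imI, u * x.imJ - ε * p * v * x.imK, v * x.imJ + ε * u * x.imK⟩ := by
  simp only [hom, QuaternionAlgebra.Basis.liftHom_apply, QuaternionAlgebra.Basis.lift]
  ext <;> simp <;> ring

theorem hom_injective (p q q' : ℕ) (ε u v : ℚ) (hε : ε * ε = 1)
    (h : q * (u ^ 2 + p * v ^ 2) = q') (hq' : q' ≠ 0) :
    Function.Injective (hom p q q' ε u v hε h) := by
  have hq0 : (q' : ℚ) ≠ 0 := by exact_mod_cast hq'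
  refine (injective_iff_map_eq_zero _).2 fun x hx => ?_
  rw [hom_apply, QuaternionAlgebra.ext_iff] at hx
  obtain ⟨h1, h2, h3, h4⟩ := hx
  simp only [QuaternionAlgebra.re_zero, QuaternionAlgebra.imI_zero, QuaternionAlgebra.imJ_zero,
    QuaternionAlgebra.imK_zero] at h1 h2 h3 h4
  ext
  · exact h1
  · simp only [QuaternionAlgebra.imI_zero]
    linear_combination ε * h2 - x.imI * hε
  · refine (mul_eq_zero.1 ?_).resolve_left hq0
    linear_combination q * u * h3 + q * p * v * h4 - x.imJ * h
  · refine (mul_eq_zero.1 ?_).resolve_left hq0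
    linear_combination
      q * ε * u * h4 - q * ε * v * h3 - x.imK * h - x.imK * q * (u ^ 2 + p * v ^ 2) * hε

/-- If `q₂` is a value of `q₁ X ^ 2 + 4 r₁ X Y + 4 m Y ^ 2`, that is, if some vector
`perp p q₁ r₁ x (2 * y)` has norm `q₂`, then sending `β` to this vector and `α` to `α` or `-α`
carries one order onto the other. -/
theorem nonempty_ringEquiv_of_norm_eq {p q₁ q₂ : ℕ} (hq₁ : q₁ % 8 = 3) (hq₂ : q₂ % 8 = 3)
    (hq₂' : q₂.Prime) {r₁ r₂ m : ℤ} (hr₁ : (q₁ : ℤ) ∣ r₁ ^ 2 + p) (hr₂ : (q₂ : ℤ) ∣ r₂ ^ 2 + p)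
    (hm : r₁ ^ 2 + p = q₁ * m) {x y : ℤ}
    (hxy : q₁ * x ^ 2 + 4 * r₁ * x * y + 4 * m * y ^ 2 = q₂) :
    Nonempty (order p q₂ r₂ hq₂ hr₂ ≃+* order p q₁ r₁ hq₁ hr₁) := by
  have hq₁0 : (q₁ : ℚ) ≠ 0 := by
    have : q₁ ≠ 0 := by omega
    exact_mod_cast this
  have hq₂0 : (q₂ : ℚ) ≠ 0 := by exact_mod_cast hq₂'.ne_zero
  have hpr : Prime (q₂ : ℤ) := Nat.prime_iff_prime_int.1 hq₂'
  -- The vector is primitive because its norm is squarefree; complete it to a basis.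
  obtain ⟨w, z, hwz⟩ : ∃ w z : ℤ, x * w - 2 * y * z = 1 := by
    have hc : IsCoprime x (2 * y) := by
      rw [Int.isCoprime_iff_gcd_eq_one, ← Int.natAbs_natCast (Int.gcd x (2 * y)),
        ← Int.isUnit_iff_natAbs_eq]
      refine hpr.squarefree _ ?_
      obtain ⟨s, hs⟩ := Int.gcd_dvd_left x (2 * y)
      obtain ⟨t, ht⟩ := Int.gcd_dvd_right x (2 * y)
      generalize (Int.gcd x (2 * y) : ℤ) = g at *
      refine ⟨q₁ * s ^ 2 + 2 * r₁ * s * t + m * t ^ 2, ?_⟩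
      linear_combination (norm := skip) -hxy
      rw [show 4 * r₁ * x * y = 2 * r₁ * x * (2 * y) by ring,
        show 4 * m * y ^ 2 = m * (2 * y) ^ 2 by ring, ht, hs]
      ring
    obtain ⟨a, b, hab⟩ := hc
    exact ⟨a, -b, by linear_combination hab⟩
  -- As `x` is odd and `2 * y` even, `(1 + β) / 2` will be sent into the order.
  have hx : x % 2 = 1 := by
    by_contra hx
    obtain ⟨k, hk⟩ : ∃ k, x = 2 * k := ⟨x / 2, by omega⟩
    have : 2 * (k * w - y * z) = 1 := by linear_combination hwz - w * hk
    omega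
  obtain ⟨k, hk⟩ : ∃ k, x = 2 * k + 1 := ⟨x / 2, by omega⟩
  -- `s` is the inner product of the two basis vectors, so that `s ^ 2 ≡ -p` modulo `q₂`.
  set s : ℤ := q₁ * x * z + r₁ * (x * w + 2 * y * z) + 2 * m * y * w with hs
  set n : ℤ := q₁ * z ^ 2 + 2 * r₁ * z * w + m * w ^ 2 with hn
  have hsn : s ^ 2 + p = q₂ * n := by
    rw [← hxy, hs, hn]
    linear_combination
      hm * (x * w - 2 * y * z) ^ 2 - (p : ℤ) * (x * w - 2 * y * z + 1) * hwz
  -- The sign `ε` of the image of `α` is chosen so that `ε r₂ ≡ s` modulo `q₂`.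
  obtain ⟨ε, l, hε, hl⟩ : ∃ ε l : ℤ, ε * ε = 1 ∧ r₂ = ε * (s + l * q₂) := by
    have hd : (q₂ : ℤ) ∣ (r₂ - s) * (r₂ + s) := by
      have := dvd_sub hr₂ (Dvd.intro _ hsn.symm)
      rwa [show r₂ ^ 2 + (p : ℤ) - (s ^ 2 + p) = (r₂ - s) * (r₂ + s) by ring] at this
    rcases hpr.dvd_or_dvd hd with ⟨l, hl⟩ | ⟨l, hl⟩
    · exact ⟨1, l, rfl, by linear_combination hl⟩
    · exact ⟨-1, -l, rfl, by linear_combination hl⟩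
  have hεQ : (ε : ℚ) * ε = 1 := by exact_mod_cast hε
  have hmQ : (r₁ : ℚ) ^ 2 + p = q₁ * m := by exact_mod_cast hm
  have hxyQ : (q₁ : ℚ) * x ^ 2 + 4 * r₁ * x * y + 4 * m * y ^ 2 = q₂ := by exact_mod_cast hxy
  have hwzQ : (x : ℚ) * w - 2 * y * z = 1 := by exact_mod_cast hwz
  have hlQ : (r₂ : ℚ) = ε * (s + l * q₂) := by exact_mod_cast hl
  have hsQ : (s : ℚ) = q₁ * x * z + r₁ * (x * w + 2 * y * z) + 2 * m * y * w := by
    exact_mod_cast hs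
  have hnorm : (q₁ : ℚ) * ((x + 2 * y * r₁ / q₁ : ℚ) ^ 2 + p * (2 * y / q₁ : ℚ) ^ 2) = q₂ := by
    rw [← hxyQ]
    field_simp
    linear_combination 4 * (y : ℚ) ^ 2 * hmQ
  set φ := hom p q₁ q₂ ε _ _ hεQ hnorm with hφ
  have hφα : φ (α p q₂) = ε • α p q₁ := by
    rw [hφ, hom_apply]
    ext <;> simp [α]
  have hφβ : φ (β p q₂) = perp p q₁ r₁ x (2 * y) := by
    rw [hφ, hom_apply]
    ext <;> simp [β, perp]
  have hφγ : φ (perp p q₂ r₂ 0 1) = ε • (perp p q₁ r₁ (z + l * x) (w + l * (2 * y))) := by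
    rw [hφ, hom_apply]
    have hJ : (s : ℚ) * (q₁ * x + 2 * y * r₁) - 2 * p * y = q₂ * (q₁ * z + w * r₁) := by
      linear_combination (q₁ * x + 2 * y * r₁ : ℚ) * hsQ + (q₁ * z + w * r₁ : ℚ) * hxyQ
        - 2 * y * (x * w - 2 * y * z : ℚ) * hmQ + 2 * y * p * hwzQ
    have hK : 2 * (y : ℚ) * s + (q₁ * x + 2 * y * r₁) = w * q₂ := by
      linear_combination 2 * y * hsQ + w * hxyQ - (q₁ * x + 2 * y * r₁ : ℚ) * hwzQ
    ext <;> simp [perp] <;> rw [hlQ] <;> field_simp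
    · linear_combination (ε : ℚ) * hJ
    · linear_combination (ε : ℚ) * hK
  let R : Subring (QuatAlg p q₁) := (order p q₂ r₂ hq₂ hr₂).map (φ : QuatAlg p q₂ →+* QuatAlg p q₁)
  have hφβ' : φ ((1 / 2 : ℚ) • (1 + β p q₂)) =
      (1 / 2 : ℚ) • (1 + β p q₁) + perp p q₁ r₁ k y := by
    rw [map_smul, map_add, map_one, hφβ]
    ext <;> simp [perp, β, hk] <;> ring
  have hle : R ≤ order p q₁ r₁ hq₁ hr₁ := by
    refine Subring.map_le_iff_le_comap.2 (order_le ?_ ?_ ?_)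
    · refine (?_ : φ _ ∈ lattice p q₁ r₁)
      rw [hφα]
      exact Submodule.smul_mem _ _ (α_mem_lattice (by omega) _)
    · refine (?_ : φ _ ∈ lattice p q₁ r₁)
      rw [hφβ']
      exact add_mem (half_one_add_β_mem_lattice _ _ _) (perp_mem_lattice _ _ _ _ _)
    · refine (?_ : φ _ ∈ lattice p q₁ r₁)
      rw [hφγ]
      exact Submodule.smul_mem _ _ (perp_mem_lattice _ _ _ _ _)
  have hge : order p q₁ r₁ hq₁ hr₁ ≤ R := by
    have hR : ∀ a ∈ lattice p q₂ r₂, φ a ∈ R := fun a ha => ⟨a, ha, rfl⟩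
    have h1 : perp p q₁ r₁ x (2 * y) ∈ R := hφβ ▸ hR _ (by
      convert perp_mem_lattice p q₂ r₂ 1 0 using 1
      ext <;> simp [β, perp])
    have h2 : perp p q₁ r₁ z w ∈ R := by
      have := R.sub_mem (R.zsmul_mem (hR _ (perp_mem_lattice p q₂ r₂ 0 1)) ε) (R.zsmul_mem h1 l)
      convert this using 1
      rw [hφγ, smul_smul, hε]
      ext <;> simp [perp] <;> ring
    have h3 : ∀ a b : ℤ, perp p q₁ r₁ a b ∈ R := by
      intro a b
      convert R.add_mem (R.zsmul_mem h1 (a * w - b * z)) (R.zsmul_mem h2 (b * x - a * (2 * y)))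
        using 1
      ext <;> simp [perp]
      · linear_combination (-(a + b * r₁ / q₁) : ℚ) * hwzQ
      · linear_combination (-(b / q₁) : ℚ) * hwzQ
    refine order_le ?_ ?_ (h3 0 1)
    · convert hR _ (Submodule.smul_mem _ ε (α_mem_lattice hq₂'.ne_zero r₂)) using 1
      rw [map_zsmul, hφα, smul_smul, hε, one_smul]
    · convert R.sub_mem (hR _ (half_one_add_β_mem_lattice p q₂ r₂)) (h3 k y) using 1
      rw [hφβ', add_sub_cancel_right]
  have hRe : R = order p q₁ r₁ hq₁ hr₁ := le_antisymm hle hge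
  exact ⟨((order p q₂ r₂ hq₂ hr₂).equivMapOfInjective (φ : QuatAlg p q₂ →+* QuatAlg p q₁)
    (hom_injective p q₁ q₂ ε _ _ hεQ hnorm hq₂'.ne_zero)).trans (RingEquiv.subringCongr hRe)⟩

end QuatAlg

namespace QuatAlg

/-! ### Representations from isomorphisms -/

/-- An element `b` with `α b = -b α` and `(1 + b) / 2` in the order is `perp p q r x (2 * y)`, so
its square exhibits a value of the form `q X ^ 2 + 4 r X Y + 4 m Y ^ 2`. -/
theorem exists_norm_eq_of_anticommute {p q : ℕ} (hp : p ≠ 0) (hq : q ≠ 0) {r m n : ℤ}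
    (hm : r ^ 2 + p = q * m) {b h : QuatAlg p q} (hh : h ∈ lattice p q r) (hbh : 2 * h = 1 + b)
    (hαb : α p q * b = -(b * α p q)) (hb : b * b = -(n : QuatAlg p q)) :
    ∃ x y : ℤ, q * x ^ 2 + 4 * r * x * y + 4 * m * y ^ 2 = n := by
  have hpQ : (p : ℚ) ≠ 0 := by exact_mod_cast hp
  have hqQ : (q : ℚ) ≠ 0 := by exact_mod_cast hq
  have hmQ : (r : ℚ) ^ 2 + p = q * m := by exact_mod_cast hm
  obtain ⟨s, t, u, v, rfl⟩ := mem_lattice_iff.1 hh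
  obtain rfl : b = 2 * (⟨s + t / 2, u / 2, t / 2 + v * r / q, u / 2 + v / q⟩ : QuatAlg p q) - 1 :=
    by rw [hbh]; abel
  rw [two_mul] at hαb hb
  refine ⟨t, v, ?_⟩
  have h1 := congrArg QuaternionAlgebra.re hαb
  have h2 := congrArg QuaternionAlgebra.imI hαb
  have h3 := congrArg QuaternionAlgebra.re hb
  simp [α] at h1 h2 h3
  have hu : (u : ℚ) = 0 := by
    have : (p : ℚ) * u = 0 := by linarith
    exact (mul_eq_zero.1 this).resolve_left hpQ
  have hs : (s : ℚ) + t / 2 = 1 / 2 := by linarith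
  rw [hs, hu] at h3
  have : (q : ℚ) * t ^ 2 + 4 * r * t * v + 4 * m * v ^ 2 = n := by
    refine mul_left_cancel₀ hqQ ?_
    field_simp at h3
    linear_combination -h3 / 4 - 4 * (v : ℚ) ^ 2 * hmQ
  exact_mod_cast this

/-- An element of the order with square `-p` is `α u` for an element `u` of the order of norm `1`.
The reason is that `α` generates the prime ideal above `p`, which consists of all elements of norm
divisible by `p`. The coordinates of `u` are given explicitly: it has trace `c` and no component
along `α`. -/
theorem exists_eq_α_mul {p q : ℕ} (hp : p.Prime) (hp2 : p ≠ 2) (hq : q.Prime) (hpq : p ≠ q)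
    {r : ℤ} (hr : (q : ℤ) ∣ r ^ 2 + p) {a : QuatAlg p q} (ha : a ∈ lattice p q r)
    (haa : a * a = -(p : QuatAlg p q)) :
    ∃ c k n : ℤ, a = α p q * ⟨c / 2, 0, c / 2 + k + n * r / q, n / q⟩ ∧
      (c / 2 : ℚ) ^ 2 + q * (c / 2 + k + n * r / q : ℚ) ^ 2 + p * n ^ 2 / q = 1 := by
  have hp0 : (p : ℚ) ≠ 0 := by exact_mod_cast hp.ne_zero
  have hq0 : (q : ℚ) ≠ 0 := by exact_mod_cast hq.ne_zero
  obtain ⟨m, hm⟩ := hr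
  have hmQ : (r : ℚ) ^ 2 + p = q * m := by exact_mod_cast hm
  obtain ⟨s, t, c, d, rfl⟩ := mem_lattice_iff.1 ha
  have h0 := congrArg QuaternionAlgebra.re haa
  have h1 := congrArg QuaternionAlgebra.imI haa
  have h2 := congrArg QuaternionAlgebra.imJ haa
  have h3 := congrArg QuaternionAlgebra.imK haa
  simp at h0 h1 h2 h3
  have hre : (s : ℚ) + t / 2 = 0 := by
    by_contra hne
    have hc : (c : ℚ) / 2 = 0 := (mul_eq_zero.1 (by linear_combination h1 / 2)).resolve_left hne
    have hj : (t : ℚ) / 2 + d * r / q = 0 :=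
      (mul_eq_zero.1 (by linear_combination h2 / 2)).resolve_left hne
    have hk : (c : ℚ) / 2 + d / q = 0 :=
      (mul_eq_zero.1 (by linear_combination h3 / 2)).resolve_left hne
    rw [hk, hj, hc] at h0
    have : (0 : ℚ) < p := by exact_mod_cast hp.pos
    nlinarith [mul_self_nonneg ((s : ℚ) + t / 2)]
  have ht : (t : ℚ) = -2 * s := by linarith
  rw [hre, ht] at h0
  have hN : (p : ℚ) * q * c ^ 2 + 4 * (q * s - d * r) ^ 2 + p * (q * c + 2 * d) ^ 2 = 4 * p * q := by
    field_simp at h0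
    linear_combination -h0
  have hNZ : (p : ℤ) * q * c ^ 2 + 4 * (q * s - d * r) ^ 2 + p * (q * c + 2 * d) ^ 2 = 4 * p * q := by
    exact_mod_cast hN
  have hpZ : Prime (p : ℤ) := Nat.prime_iff_prime_int.1 hp
  -- The trace is zero, so `p` dividing the norm forces `p` to divide the coefficient of `β`.
  obtain ⟨n, hn⟩ : (p : ℤ) ∣ q * s - d * r := by
    have h4 : (p : ℤ) ∣ 2 ^ 2 * (q * s - d * r) ^ 2 :=
      ⟨4 * q - q * c ^ 2 - (q * c + 2 * d) ^ 2, by linear_combination hNZ⟩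
    rcases hpZ.dvd_or_dvd h4 with h | h
    · have h2 : p ∣ 2 := by exact_mod_cast hpZ.dvd_of_dvd_pow h
      exact absurd ((Nat.prime_dvd_prime_iff_eq hp Nat.prime_two).1 h2) hp2
    · exact hpZ.dvd_of_dvd_pow h
  obtain ⟨k, hk⟩ : (q : ℤ) ∣ d - n * r := by
    have hcop : IsCoprime (q : ℤ) p :=
      Nat.isCoprime_iff_coprime.2 ((Nat.coprime_primes hq hp).2 hpq.symm)
    have hdvd : (q : ℤ) ∣ p * (d - n * r) :=
      ⟨d * m - r * s, by linear_combination r * hn + d * hm⟩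
    exact hcop.dvd_of_dvd_mul_left hdvd
  have hnQ : (q : ℚ) * s - d * r = p * n := by exact_mod_cast hn
  have hkQ : (d : ℚ) - n * r = q * k := by exact_mod_cast hk
  have hd : (c : ℚ) / 2 + k + n * r / q = c / 2 + d / q := by
    field_simp
    linear_combination -2 * hkQ
  refine ⟨c, k, n, ?_, ?_⟩
  · rw [hd, ht]
    ext <;> simp [α]
    · ring
    · field_simp
      linear_combination -hnQ
  · rw [hd]
    rw [hnQ] at hN
    field_simp
    refine mul_left_cancel₀ hp0 ?_
    linear_combination hN

/-- If the order contains `a`, `(1 + b) / 2` with `a ^ 2 = -p`, `b ^ 2 = -n`, `a b = -b a`, and does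
not contain `(1 + a) / 2`, then `n` is a value of `q X ^ 2 + 4 r X Y + 4 m Y ^ 2`. Writing
`a = α u`, the unit `u` has order dividing `4` or `6`. If its order is `1` or `2`, then `a = ±α`;
if it is `3` or `6`, then `a` is conjugate to `±α` by `u`; order `4` would put `(1 + a) / 2` into
the order. -/
theorem exists_norm_eq_of_mem {p q : ℕ} (hp : p.Prime) (hp4 : p % 4 = 3) (hq : q.Prime)
    (hq8 : q % 8 = 3) (hpq : p ≠ q) {r m n : ℤ} (hm : r ^ 2 + p = q * m)
    {a b h : QuatAlg p q}
    (ha : a ∈ lattice p q r) (hh : h ∈ lattice p q r) (haa : a * a = -(p : QuatAlg p q))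
    (hb : b * b = -(n : QuatAlg p q)) (hab : a * b = -(b * a)) (hbh : 2 * h = 1 + b)
    (hno : ∀ z ∈ lattice p q r, 2 * z ≠ 1 + a) :
    ∃ x y : ℤ, q * x ^ 2 + 4 * r * x * y + 4 * m * y ^ 2 = n := by
  have hr : (q : ℤ) ∣ r ^ 2 + p := ⟨m, hm⟩
  have hp0 : (0 : ℚ) < p := by exact_mod_cast hp.pos
  have hq0 : (0 : ℚ) < q := by exact_mod_cast hq.pos
  obtain ⟨c, k, l, hu, hN⟩ := exists_eq_α_mul hp (by omega) hq hpq hr ha haa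
  have hJ : 0 ≤ (q : ℚ) * (c / 2 + k + l * r / q) ^ 2 := by positivity
  have hK : 0 ≤ (p : ℚ) * l ^ 2 / q := by positivity
  have hc2 : c ^ 2 ≤ 2 ^ 2 := by
    have : (c : ℚ) ^ 2 ≤ 2 ^ 2 := by linarith
    exact_mod_cast this
  have huL : (⟨c / 2, 0, c / 2 + k + l * r / q, l / q⟩ : QuatAlg p q) ∈ lattice p q r := by
    refine mem_lattice_iff.2 ⟨-k, c + 2 * k, 0, l, ?_⟩
    ext <;> simp <;> ring
  have hsq : c = 0 ∨ c ^ 2 = 1 ∨ c ^ 2 = 4 := by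
    have h1 := abs_le_of_sq_le_sq' hc2 (by norm_num)
    obtain ⟨h1, h2⟩ := h1
    interval_cases c <;> simp
  rcases hsq with rfl | hc | hc
  · -- Here `u = perp p q r k l`, and `β` is the combination `t u - l α u` with `t` even, `l` odd.
    exfalso
    obtain ⟨t, ht⟩ : ∃ t : ℤ, t = q * k + r * l := ⟨_, rfl⟩
    have htQ : (t : ℚ) = q * k + r * l := by exact_mod_cast ht
    have hNt : (t : ℚ) ^ 2 + p * l ^ 2 = q := by
      rw [htQ]
      field_simp at hN
      simp at hN
      linear_combination hN / 4
    have hNZ : t ^ 2 + p * l ^ 2 = q := by exact_mod_cast hNt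
    have hmod : t % 2 = 0 ∧ l % 2 = 1 := by
      have h4 : (t ^ 2 + p * l ^ 2) % 4 = 3 := by rw [hNZ]; omega
      obtain ⟨p', hp'⟩ : ∃ p' : ℤ, (p : ℤ) = 4 * p' + 3 := ⟨p / 4, by omega⟩
      rw [hp'] at h4
      obtain ⟨t', rfl | rfl⟩ := Int.even_or_odd' t <;> obtain ⟨l', rfl | rfl⟩ := Int.even_or_odd' l
      all_goals ring_nf at h4
      all_goals omega
    obtain ⟨t', ht'⟩ : ∃ t', t = 2 * t' := ⟨t / 2, by omega⟩
    obtain ⟨l', hl'⟩ : ∃ l', l = 2 * l' - 1 := ⟨(l + 1) / 2, by omega⟩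
    refine hno ((1 / 2 : ℚ) • (1 + β p q) - t' • perp p q r k l + l' • a)
      (add_mem (sub_mem (half_one_add_β_mem_lattice p q r)
        (Submodule.smul_mem _ _ (perp_mem_lattice p q r k l))) (Submodule.smul_mem _ _ ha)) ?_
    have hβ : β p q = t • perp p q r k l - l • a := by
      rw [hu]
      ext <;> simp [β, perp, α]
      · field_simp
        linear_combination -hNt + t * htQ
      · field_simp
        rw [htQ]
        ring
    have h2 : (2 : QuatAlg p q) * (1 / 2 : ℚ) • (1 + β p q) = 1 + β p q := by
      rw [two_mul]
      module
    rw [mul_add, mul_sub, h2, two_mul (t' • _), two_mul (l' • a), hβ, ht', hl']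
    module
  · -- Here `u` has order `3` or `6`, and `u⁻¹ a u = α u ^ 3 = -c α`.
    have hN' : (c / 2 : ℚ) ^ 2 + q * (c / 2 + k + l * r / q : ℚ) ^ 2 +
        p * q * (l / q : ℚ) ^ 2 = 1 := by
      rw [← hN]
      field_simp
    generalize (c / 2 + k + l * r / q : ℚ) = j, (l / q : ℚ) = i at *
    set u : QuatAlg p q := ⟨c / 2, 0, j, i⟩ with hudef
    -- The conjugate of `u`, which is also its inverse.
    set v : QuatAlg p q := (c : QuatAlg p q) - u with hv
    have hvL : v ∈ lattice p q r := sub_mem (intCast_mem_lattice p q r c) huL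
    have huv : u * v = 1 := by
      rw [hv, hudef]
      ext <;> simp
      · linear_combination hN'
      all_goals ring
    have hvu : v * u = 1 := by rw [← huv, hv]; simp [mul_sub, sub_mul, Int.cast_comm]
    have hαu : α p q * u = v * α p q := by
      rw [hv, hudef]
      ext <;> simp [α]; ring
    have hmul : ∀ x y : QuatAlg p q, v * x * u * (v * y * u) = v * (x * y) * u := by
      intro x y
      calc v * x * u * (v * y * u) = v * x * (u * v) * y * u := by noncomm_ring
        _ = v * (x * y) * u := by rw [huv]; noncomm_ring
    have huu : u * u = c • u - 1 := by
      rw [← huv, hv]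
      simp [mul_sub, Int.cast_comm]
    have hva : v * a * u = -(c • α p q) := by
      rw [hu, ← mul_assoc, ← hαu, mul_assoc, mul_assoc, huu, mul_sub, mul_smul_comm, huu,
        smul_sub, smul_smul, ← sq, hc]
      simp [(Int.cast_commute c (α p q)).eq]
    have hα : α p q = -(c • (v * a * u)) := by
      rw [hva, smul_neg, smul_smul, ← sq, hc, one_smul, neg_neg]
    have hvhu : v * h * u ∈ lattice p q r :=
      mul_mem_lattice hq8 hr (mul_mem_lattice hq8 hr hvL hh) huL
    refine exists_norm_eq_of_anticommute hp.ne_zero hq.ne_zero hm (b := v * b * u) hvhu ?_ ?_ ?_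
    · calc 2 * (v * h * u) = v * (2 * h) * u := by noncomm_ring
        _ = v * u + v * b * u := by rw [hbh]; noncomm_ring
        _ = 1 + v * b * u := by rw [hvu]
    · rw [hα, neg_mul, mul_neg, smul_mul_assoc, mul_smul_comm, hmul, hmul, hab]
      simp
    · rw [hmul, hb]
      simp [mul_assoc, ← Int.cast_comm, hvu]
  · have hcQ : (c : ℚ) ^ 2 = 4 := by exact_mod_cast hc
    have hJ0 : (c / 2 + k + l * r / q : ℚ) = 0 := by
      have : (q : ℚ) * (c / 2 + k + l * r / q) ^ 2 = 0 := by linarith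
      simpa [hq0.ne'] using this
    have hl0 : (l : ℚ) = 0 := by
      have : (p : ℚ) * l ^ 2 / q = 0 := by linarith
      simpa [hq0.ne', hp0.ne'] using this
    have haα : a = (c / 2 : ℚ) • α p q := by
      rw [hu, hJ0, hl0]
      ext <;> simp [α]
    refine exists_norm_eq_of_anticommute hp.ne_zero hq.ne_zero hm hh hbh ?_ hb
    have hα : α p q = (c / 2 : ℚ) • a := by
      rw [haα, smul_smul, show (c / 2 : ℚ) * (c / 2) = 1 by linarith, one_smul]
    rw [hα, smul_mul_assoc, mul_smul_comm, hab, smul_neg]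

end QuatAlg

/-! ### Isomorphism of the orders and common representing forms -/

theorem mainTheorem9 (p q₁ q₂ : ℕ) [Fact p.Prime] [Fact q₁.Prime] [Fact q₂.Prime]
    (hp : p % 4 = 3) (hne : q₁ ≠ q₂)
    (hq₁ : q₁ % 8 = 3) (hpq₁ : legendreSym q₁ p = -1)
    (hq₂ : q₂ % 8 = 3) (hpq₂ : legendreSym q₂ p = -1)
    (r₁ r₂ : ℤ) (hr₁ : (q₁ : ℤ) ∣ r₁ ^ 2 + p) (hr₂ : (q₂ : ℤ) ∣ r₂ ^ 2 + p) :
    Nonempty (QuatAlg.order p q₁ r₁ hq₁ hr₁ ≃+* QuatAlg.order p q₂ r₂ hq₂ hr₂) ↔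
      ∃ f : BinForm, f.IsPosDef ∧ f.IsPrimitive ∧ f.IsReduced ∧ f.discr = -16 * (p : ℤ) ∧
        f.Represents q₁ ∧ f.Represents q₂ := by
  have hp' : p.Prime := Fact.out
  have hq₁' : q₁.Prime := Fact.out
  have hq₂' : q₂.Prime := Fact.out
  obtain ⟨m, hm⟩ := id hr₁
  constructor
  · -- Only the images `g a`, `g b`, `g h` of `α`, `β`, `(1 + β) / 2` under the isomorphism matter.
    rintro ⟨e⟩
    have hne₁ : p ≠ q₁ := by
      rintro rfl
      have h0 : legendreSym p p = 0 := (legendreSym.eq_zero_iff p p).2 (by simp)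
      rw [h0] at hpq₁
      norm_num at hpq₁
    have hq₂0 : (q₂ : ℚ) ≠ 0 := by exact_mod_cast hq₂'.ne_zero
    let g : QuatAlg.order p q₂ r₂ hq₂ hr₂ →+* QuatAlg p q₁ :=
      (QuatAlg.order p q₁ r₁ hq₁ hr₁).subtype.comp e.symm.toRingHom
    have hg : ∀ z, g z ∈ QuatAlg.lattice p q₁ r₁ := fun z => (e.symm z).2
    have hg2 : g 2 = 2 := map_ofNat g 2
    let a : QuatAlg.order p q₂ r₂ hq₂ hr₂ :=
      ⟨QuatAlg.α p q₂, QuatAlg.α_mem_lattice hq₂'.ne_zero r₂⟩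
    let h : QuatAlg.order p q₂ r₂ hq₂ hr₂ :=
      ⟨(1 / 2 : ℚ) • (1 + QuatAlg.β p q₂), QuatAlg.half_one_add_β_mem_lattice p q₂ r₂⟩
    let b : QuatAlg.order p q₂ r₂ hq₂ hr₂ := 2 * h - 1
    have hb : (b : QuatAlg p q₂) = QuatAlg.β p q₂ := by
      change 2 * ((1 / 2 : ℚ) • (1 + QuatAlg.β p q₂)) - 1 = _
      rw [two_mul]
      module
    have haa : a * a = -(p : QuatAlg.order p q₂ r₂ hq₂ hr₂) :=
      Subtype.ext (by simpa using QuatAlg.α_mul_α p q₂)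
    have hbb : b * b = -(q₂ : QuatAlg.order p q₂ r₂ hq₂ hr₂) :=
      Subtype.ext (by simpa [hb] using QuatAlg.β_mul_β p q₂)
    have hab : a * b = -(b * a) :=
      Subtype.ext (by simpa [hb] using QuatAlg.α_mul_β p q₂)
    -- `(1 + α) / 2` is not in the second order, as `q₂` is odd.
    have hno : ∀ z : QuatAlg.order p q₂ r₂ hq₂ hr₂, 2 * z ≠ 1 + a := by
      rintro ⟨z, hz⟩ h2
      obtain ⟨s, t, u, v, rfl⟩ := QuatAlg.mem_lattice_iff.1 hz
      have h2 := congrArg Subtype.val h2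
      change 2 * (_ : QuatAlg p q₂) = 1 + QuatAlg.α p q₂ at h2
      rw [two_mul] at h2
      have hI := congrArg QuaternionAlgebra.imI h2
      have hK := congrArg QuaternionAlgebra.imK h2
      simp [QuatAlg.α] at hI hK
      have huv : (q₂ : ℚ) + 2 * v = 0 := by
        field_simp at hK
        rw [hI, Int.cast_one] at hK
        linarith
      have huv' : (q₂ : ℤ) + 2 * v = 0 := by exact_mod_cast huv
      omega
    obtain ⟨x, y, hxy⟩ := QuatAlg.exists_norm_eq_of_mem (n := q₂) hp' hp hq₁' hq₁ hne₁ hm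
      (a := g a) (b := g b) (h := g h) (hg a) (hg h)
      (by rw [← map_mul, haa, map_neg, map_natCast])
      (by rw [← map_mul, hbb, map_neg, map_natCast, Int.cast_natCast])
      (by rw [← map_mul, hab, map_neg, map_mul])
      (by simp [b, hg2])
      (by
        intro z hz h2
        have h2' : 2 * (⟨z, hz⟩ : QuatAlg.order p q₁ r₁ hq₁ hr₁) = 1 + e.symm a := Subtype.ext h2
        refine hno (e ⟨z, hz⟩) ?_
        rw [← map_ofNat e 2, ← map_mul, h2', map_add, map_one, e.apply_symm_apply])
    let f : BinForm := ⟨q₁, 4 * r₁, 4 * m⟩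
    have hD : f.discr = -16 * (p : ℤ) := by
      simp only [f, BinForm.discr]
      linear_combination 16 * hm
    have hf : f.IsPosDef := by
      refine ⟨?_, Int.natCast_pos.2 hq₁'.pos⟩
      have := hp'.pos
      omega
    obtain ⟨f', hpos, hred, hD', hrep⟩ := hf.exists_isReduced
    have h₁ : f'.Represents q₁ := hrep _ ⟨1, 0, by simp [f, BinForm.eval]⟩
    have h₂ : f'.Represents q₂ := hrep _ ⟨x, y, by simp only [f, BinForm.eval]; exact hxy⟩
    exact ⟨f', hpos, BinForm.isPrimitive_of_represents hq₁' hq₂' hne h₁ h₂, hred, hD'.trans hD,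
      h₁, h₂⟩
  · rintro ⟨f, -, -, -, hD, h₁, h₂⟩
    obtain ⟨x, y, hxy⟩ := h₁.exists_norm_eq hq₁' hD hm h₂
    exact (QuatAlg.nonempty_ringEquiv_of_norm_eq hq₁ hq₂ hq₂' hr₁ hr₂ hm hxy).map RingEquiv.symm
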